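/- Let $\beta_c=\sqrt{2\log 2}$ and $\beta_c<\beta<\infty$. A sequence of random energy models is a family of random variables $H_N(\sigma)$, $\sigma\in\{-1,+1\}^N$, $N\ge 1$, on one probability space such that for each $N$ the $2^N$ energies $H_N(\sigma)$ are i.i.d. Gaussian with mean $0$ and variance $N$; the joint law of different $N$ is arbitrary. Its Gibbs measure is $\mu_{N,\beta}(\sigma)=e^{-\beta H_N(\sigma)}/\sum_{\sigma'}e^{-\beta H_N(\sigma')}$. Let $n=2^N$, let $\tilde\sigma_1,\dots,\tilde\sigma_n$ be the configurations ordered by nondecreasing energy (so $\tilde\sigma_1$ has minimal energy; $\tilde\sigma_j$ depends on $N$ and on the sample), let $\Phi$ be the standard normal distribution function, $U_{j,n}=\Phi(H_N(\tilde\sigma_j)/\sqrt N)$ for $1\le j\le n$, $U_{n+1,n}=1$, and $$W_i^{(N)}=i\log\frac{U_{i+1,n}}{U_{i,n}}\qquad(1\le i\le n).$$ Let $d_{TV}(\mu,\nu)=\sup_{\|\Psi\|_\infty=1}|\mu(\Psi)-\nu(\Psi)|$ and $$b(w_1,w_2)=\frac{\exp\left(-\frac{\beta}{\beta_c}\left(w_1+\frac{w_2}{2}\right)\right)}{1+\exp\left(-\frac{\beta}{\beta_c}\left(w_1+\frac{w_2}{2}\right)\right)}>0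 .$$ The Gibbs measure is not concentrated on the minimum, in the following sense. 1. For every $N\ge1$ and every energy function on $\{-1,+1\}^N$, $\mu_{N,\beta}\ne\delta_{\tilde\sigma_1}$. 2. For every sequence of random energy models: for each $N\ge 1$ the variables $W^{(N)}_1,\dots,W^{(N)}_{2^N}$ are i.i.d. exponential with mean $1$, and almost surely $$\liminf_{N\to\infty}\left(d_{TV}(\mu_{N,\beta},\delta_{\tilde\sigma_1})-b(W^{(N)}_1,W^{(N)}_2)\right)\ge 0 .$$ 3. If moreover one sequence $(W_i)_{i\ge1}$ represents all volumes, that is, if almost surely $W_i^{(N)}=W_i$ for all $N\ge1$ and $1\le i\le 2^N$, then the $W_i$ are i.i.d. exponential with mean $1$ and, almost surely, $$\liminf_{N\to\infty}d_{TV}(\mu_{N,\beta},\delta_{\tilde\sigma_1})\ \ge\ b(W_1,W_2)\ >\ 0 .$$ 4. A sequence of random energy models represented by one sequence $(W_i)_{i\ge 1}$ in this sense exists. -/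

import Mathlib

open MeasureTheory ProbabilityTheory Filter
open scoped NNReal ENNReal

namespace REM

/-- The critical inverse temperature `β_c = √(2 log 2)`. -/
noncomputable def betaC : ℝ := Real.sqrt (2 * Real.log 2)

/-- Spin configurations `{-1, +1}^N`. -/
abbrev Config (N : ℕ) : Type := Fin N → ℤˣ

theorem card_config (N : ℕ) : Fintype.card (Config N) = 2 ^ N := by
  simp [Config]

/-- A fixed enumeration of `{-1, +1}^N`. -/
noncomputable def enum (N : ℕ) : Fin (2 ^ N) ≃ Config N :=
  (Fintype.equivFinOfCardEq (card_config N)).symm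

/-- For an energy landscape `h` on `{-1, +1}^N`, the enumeration of the configurations by
nondecreasing energy (the place `j : Fin (2 ^ N)` is counted from `0`; ties, which have
probability zero in the model, are broken by `enum`). -/
noncomputable def sortedConfig {N : ℕ} (h : Config N → ℝ) : Fin (2 ^ N) ≃ Config N :=
  (Tuple.sort (h ∘ enum N)).trans (enum N)

theorem monotone_sortedConfig {N : ℕ} (h : Config N → ℝ) :
    Monotone (fun j => h (sortedConfig h j)) :=
  Tuple.monotone_sort (h ∘ enum N)

/-- The configuration of minimal energy. -/
noncomputable def minConfig {N : ℕ} (h : Config N → ℝ) : Config N :=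
  sortedConfig h ⟨0, by positivity⟩

theorem minConfig_le {N : ℕ} (h : Config N → ℝ) (σ : Config N) : h (minConfig h) ≤ h σ := by
  have := monotone_sortedConfig h (a := ⟨0, by positivity⟩) (b := (sortedConfig h).symm σ)
    (Fin.mk_le_of_le_val (Nat.zero_le _))
  simpa [minConfig] using this

/-- The partition function `Z = ∑ exp(-β h(σ))`. -/
noncomputable def partitionFunction {N : ℕ} (β : ℝ) (h : Config N → ℝ) : ℝ :=
  ∑ σ, Real.exp (-β * h σ)

theorem partitionFunction_pos {N : ℕ} (β : ℝ) (h : Config N → ℝ) :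
    0 < partitionFunction β h :=
  Finset.sum_pos (fun _ _ => Real.exp_pos _) Finset.univ_nonempty

/-- The Gibbs measure: the configuration `σ` has mass `exp(-β h(σ)) / Z`. -/
noncomputable def gibbs {N : ℕ} (β : ℝ) (h : Config N → ℝ) : PMF (Config N) :=
  PMF.ofFintype (fun σ => ENNReal.ofReal (Real.exp (-β * h σ) / partitionFunction β h)) (by
    rw [← ENNReal.ofReal_sum_of_nonneg
      (fun σ _ => div_nonneg (Real.exp_pos _).le (partitionFunction_pos β h).le),
      ← Finset.sum_div]
    exact (congrArg ENNReal.ofReal (div_self (partitionFunction_pos β h).ne')).trans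
      ENNReal.ofReal_one)

/-- The expectation `μ(Ψ)`. -/
noncomputable def expect {N : ℕ} (μ : PMF (Config N)) (Ψ : Config N → ℝ) : ℝ :=
  ∑ σ, Ψ σ * (μ σ).toReal

/-- The total variation distance `sup {|μ(Ψ) - ν(Ψ)| : ‖Ψ‖_∞ = 1}`; the norm on
`Config N → ℝ` is the sup norm. -/
noncomputable def dTV {N : ℕ} (μ ν : PMF (Config N)) : ℝ :=
  sSup {r : ℝ | ∃ Ψ : Config N → ℝ, ‖Ψ‖ = 1 ∧ r = |expect μ Ψ - expect ν Ψ|}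

/-- The uniform order statistics `U_{0,n} = 0 < U_{1,n} ≤ … ≤ U_{n,n} < U_{n+1,n} = 1`, `n = 2^N`,
of the sample `Φ(h(σ) / √N)`, with `Φ` the standard normal distribution function. -/
noncomputable def uniformOrderStat {N : ℕ} (h : Config N → ℝ) (i : ℕ) : ℝ :=
  if i = 0 then 0
  else if hi : i - 1 < 2 ^ N then
    cdf (gaussianReal 0 1) (h (sortedConfig h ⟨i - 1, hi⟩) / Real.sqrt N)
  else 1

/-- The normalized logarithmic spacings
`W_i = - log ((U_{i,n} / U_{i+1,n}) ^ i) = i log (U_{i+1,n} / U_{i,n})`, `1 ≤ i ≤ n = 2^N`. -/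
noncomputable def spacing {N : ℕ} (h : Config N → ℝ) (i : ℕ) : ℝ :=
  i * Real.log (uniformOrderStat h (i + 1) / uniformOrderStat h i)

/-- `H` is a sequence of random energy models: for each volume `N ≥ 1` the energies
`H_N(σ)`, `σ ∈ {-1, +1}^N`, are i.i.d. Gaussian with mean `0` and variance `N`.
Nothing is prescribed on the joint law of different volumes. -/
structure IsREM {Ω : Type*} [MeasurableSpace Ω] (P : Measure Ω)
    (H : (N : ℕ) → Ω → Config N → ℝ) : Prop where
  law : ∀ N, 1 ≤ N → ∀ σ, HasLaw (fun ω => H N ω σ) (gaussianReal 0 (N : ℝ≥0)) P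
  indep : ∀ N, 1 ≤ N → iIndepFun (fun σ ω => H N ω σ) P

/-- The samples of all volumes are represented by one and the same sequence
`(W_i)_{i ≥ 1}` (the value `W 0` is not used): almost surely
`log (U_{i,n} / U_{i+1,n}) = - W_i / i` for all `1 ≤ i ≤ n = 2^N`. -/
def RepresentedBy {Ω : Type*} [MeasurableSpace Ω] (P : Measure Ω)
    (H : (N : ℕ) → Ω → Config N → ℝ) (W : ℕ → Ω → ℝ) : Prop :=
  ∀ N, 1 ≤ N → ∀ i, 1 ≤ i → i ≤ 2 ^ N → ∀ᵐ ω ∂P, spacing (H N ω) i = W i ω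

/-- The lower bound
`exp(-(β/β_c)(w₁ + w₂/2)) / (1 + exp(-(β/β_c)(w₁ + w₂/2)))`. -/
noncomputable def lowerBound (β w₁ w₂ : ℝ) : ℝ :=
  Real.exp (-(β / betaC) * (w₁ + w₂ / 2)) / (1 + Real.exp (-(β / betaC) * (w₁ + w₂ / 2)))

end REM

namespace REM

theorem pi_withDensity_ofReal {ι : Type*} [Fintype ι] {f : ℝ → ℝ} (hf : Integrable f)
    (h0 : ∀ x, 0 ≤ f x) :
    Measure.pi (fun _ : ι => volume.withDensity fun x => ENNReal.ofReal (f x)) =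
      (volume : Measure (ι → ℝ)).withDensity fun x => ∏ i, ENNReal.ofReal (f (x i)) := by
  have : IsFiniteMeasure (volume.withDensity fun x => ENNReal.ofReal (f x)) :=
    isFiniteMeasure_withDensity_ofReal hf.2
  refine Measure.pi_eq fun s hs => ?_
  rw [withDensity_apply _ (MeasurableSet.univ_pi hs), volume_pi, Measure.restrict_pi_pi]
  simp_rw [withDensity_apply _ (hs _),
    ← ENNReal.ofReal_prod_of_nonneg (fun i _ => h0 _)]
  rw [← ofReal_integral_eq_lintegral_ofReal
    (Integrable.fintype_prod (f := fun _ => f) fun i => hf.restrict)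
    (ae_of_all _ fun x => Finset.prod_nonneg fun i _ => h0 _),
    integral_fintype_prod_eq_prod (f := fun _ => f),
    ENNReal.ofReal_prod_of_nonneg (fun i _ => integral_nonneg h0)]
  exact Finset.prod_congr rfl fun i _ =>
    ofReal_integral_eq_lintegral_ofReal hf.restrict (ae_of_all _ h0)

theorem integrable_exponentialPDFReal : Integrable (exponentialPDFReal 1) := by
  refine ⟨(measurable_exponentialPDFReal 1).aestronglyMeasurable, ?_⟩
  rw [hasFiniteIntegral_iff_ofReal (ae_of_all _ (exponentialPDFReal_nonneg one_pos))]
  exact (lintegral_exponentialPDF_eq_one one_pos).trans_lt ENNReal.one_lt_top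

theorem pi_expMeasure_eq (n : ℕ) :
    Measure.pi (fun _ : Fin n => expMeasure 1) =
      (volume : Measure (Fin n → ℝ)).withDensity fun x => ∏ i, exponentialPDF 1 (x i) :=
  pi_withDensity_ofReal integrable_exponentialPDFReal (exponentialPDFReal_nonneg one_pos)

variable {n : ℕ}

/-- The extension of a finite tuple to `ℕ` by zero. -/
def extendZero (e : Fin n → ℝ) (k : ℕ) : ℝ := if h : k < n then e ⟨k, h⟩ else 0

@[simp]
theorem extendZero_coe (e : Fin n → ℝ) (i : Fin n) : extendZero e i = e i := by
  simp [extendZero]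

theorem extendZero_of_le (e : Fin n → ℝ) {k : ℕ} (hk : n ≤ k) : extendZero e k = 0 := by
  simp [extendZero, hk]

/-- The weighted spacings `(i + 1) (e i - e (i + 1))` of a tuple extended by zero. -/
def weightedSpacing (n : ℕ) : (Fin n → ℝ) →ₗ[ℝ] (Fin n → ℝ) where
  toFun e i := (i + 1) * (extendZero e i - extendZero e (i + 1))
  map_add' x y := by
    ext i
    simp only [extendZero, Pi.add_apply]
    split_ifs <;> ring
  map_smul' c x := by
    ext i
    simp only [extendZero, Pi.smul_apply, smul_eq_mul, RingHom.id_apply]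
    split_ifs <;> ring

theorem weightedSpacing_apply (e : Fin n → ℝ) (i : Fin n) :
    weightedSpacing n e i = (i + 1) * (extendZero e i - extendZero e (i + 1)) := rfl

theorem sum_weightedSpacing (e : Fin n → ℝ) : ∑ i, weightedSpacing n e i = ∑ i, e i := by
  have key (a : ℕ → ℝ) (m : ℕ) : ∑ k ∈ Finset.range m, ((k : ℝ) + 1) * (a k - a (k + 1)) =
      ∑ k ∈ Finset.range m, a k - m * a m := by
    induction m with
    | zero => simp
    | succ m ih =>
      rw [Finset.sum_range_succ, Finset.sum_range_succ, ih]
      push_cast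
      ring
  simp only [weightedSpacing_apply]
  rw [Fin.sum_univ_eq_sum_range
    (fun k => ((k : ℝ) + 1) * (extendZero e k - extendZero e (k + 1))) n, key,
    extendZero_of_le e le_rfl, ← Fin.sum_univ_eq_sum_range]
  simp

theorem det_weightedSpacing_ne_zero (n : ℕ) : LinearMap.det (weightedSpacing n) ≠ 0 := by
  have hk : LinearMap.ker (weightedSpacing n) = ⊥ := by
    rw [LinearMap.ker_eq_bot']
    intro e he
    have hs (k : ℕ) (hk : k < n) : extendZero e k = extendZero e (k + 1) := by
      have := congrFun he ⟨k, hk⟩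
      rw [weightedSpacing_apply] at this
      have h1 : ((k : ℝ) + 1) ≠ 0 := by positivity
      simpa [h1, sub_eq_zero] using this
    have h0 (m k : ℕ) (hm : n ≤ k + m) : extendZero e k = 0 := by
      induction m generalizing k with
      | zero => exact extendZero_of_le e (by simpa using hm)
      | succ m ih =>
        by_cases hkn : k < n
        · rw [hs k hkn]
          exact ih _ (by omega)
        · exact extendZero_of_le e (by omega)
    ext i
    simpa using h0 n i (by omega)
  exact (LinearMap.isUnit_det _ ((LinearMap.isUnit_iff_ker_eq_bot _).2 hk)).ne_zero

theorem weightedSpacing_pos_iff (e : Fin n → ℝ) :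
    (∀ i, 0 < weightedSpacing n e i) ↔ StrictAnti e ∧ ∀ i, 0 < e i := by
  have hiff : (∀ i, 0 < weightedSpacing n e i) ↔
      ∀ k < n, extendZero e (k + 1) < extendZero e k := by
    simp only [weightedSpacing_apply, Fin.forall_iff]
    refine forall₂_congr fun k hk => ?_
    rw [mul_pos_iff_of_pos_left (by positivity), sub_pos]
  rw [hiff]
  constructor
  · intro h
    have key (m k : ℕ) (hk : k + m + 1 ≤ n) : extendZero e (k + m + 1) < extendZero e k := by
      induction m with
      | zero => exact h k (by omega)
      | succ m ih => exact (h (k + m + 1) (by omega)).trans (ih (by omega))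
    refine ⟨fun i j hij => ?_, fun i => ?_⟩
    · obtain ⟨m, hm⟩ : ∃ m, (j : ℕ) = i + m + 1 := ⟨j - i - 1, by omega⟩
      have := key m i (by omega)
      rwa [← hm, extendZero_coe, extendZero_coe] at this
    · obtain ⟨m, hm⟩ : ∃ m, n = i + m + 1 := ⟨n - i - 1, by omega⟩
      have := key m i (by omega)
      rwa [← hm, extendZero_coe, extendZero_of_le e le_rfl] at this
  · rintro ⟨h, h0⟩ k hk
    rw [extendZero, extendZero, dif_pos hk]
    split_ifs with hk'
    · exact h (Fin.mk_lt_mk.2 k.lt_succ_self)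
    · exact h0 _

theorem prod_exponentialPDF_of_nonneg {e : Fin n → ℝ} (he : ∀ i, 0 ≤ e i) :
    ∏ i, exponentialPDF 1 (e i) = ENNReal.ofReal (Real.exp (-∑ i, e i)) := by
  simp_rw [fun i => exponentialPDF_of_nonneg (r := 1) (he i)]
  rw [← ENNReal.ofReal_prod_of_nonneg (fun i _ => by positivity), ← Finset.sum_neg_distrib,
    Real.exp_sum]
  simp

theorem measurable_weightedSpacing (n : ℕ) : Measurable (weightedSpacing n) :=
  (LinearMap.continuous_on_pi _).measurable

/-- The positive orthant. -/
def posOrthant (n : ℕ) : Set (Fin n → ℝ) := {e | ∀ i, 0 < e i}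

theorem measurableSet_posOrthant (n : ℕ) : MeasurableSet (posOrthant n) := by
  have : posOrthant n = ⋂ i, {e | 0 < e i} := by ext; simp [posOrthant]
  rw [this]
  exact MeasurableSet.iInter fun i => measurableSet_lt measurable_const (measurable_pi_apply i)

instance : IsProbabilityMeasure (expMeasure 1) := isProbabilityMeasure_expMeasure one_pos

theorem expMeasure_Iic_zero : expMeasure 1 (Set.Iic 0) = 0 := by
  rw [← ofReal_cdf, cdf_expMeasure_eq one_pos]
  simp

theorem ae_pi_expMeasure_mem_posOrthant (n : ℕ) :
    ∀ᵐ e ∂Measure.pi (fun _ : Fin n => expMeasure 1), e ∈ posOrthant n := by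
  refine ae_all_iff.2 fun i => ?_
  refine (measurePreserving_eval (fun _ : Fin n => expMeasure 1) i).quasiMeasurePreserving.ae
    (p := fun x => 0 < x) ?_
  rw [ae_iff]
  convert expMeasure_Iic_zero using 2
  ext; simp

theorem ae_pi_expMeasure_injective (n : ℕ) :
    ∀ᵐ e ∂Measure.pi (fun _ : Fin n => expMeasure 1), Function.Injective e := by
  have h (i j : Fin n) (hij : i ≠ j) :
      ∀ᵐ e ∂Measure.pi (fun _ : Fin n => expMeasure 1), e i ≠ e j := by
    rw [pi_expMeasure_eq]
    refine (withDensity_absolutelyContinuous _ _).ae_le (ae_iff.2 ?_)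
    let φ : (Fin n → ℝ) →ₗ[ℝ] ℝ :=
      LinearMap.proj (R := ℝ) (φ := fun _ => ℝ) i - LinearMap.proj (R := ℝ) (φ := fun _ => ℝ) j
    have hφ (e) : φ e = e i - e j := rfl
    have := Measure.addHaar_submodule (volume : Measure (Fin n → ℝ)) (LinearMap.ker φ) (by
      intro h
      have h1 : Pi.single i (1 : ℝ) ∈ LinearMap.ker φ := h ▸ Submodule.mem_top
      simp [hφ, hij.symm] at h1)
    convert this using 2
    ext e
    simp [hφ, sub_eq_zero]
  have h' : ∀ᵐ e ∂Measure.pi (fun _ : Fin n => expMeasure 1), ∀ i j, i ≠ j → e i ≠ e j := by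
    refine ae_all_iff.2 fun i => ae_all_iff.2 fun j => ?_
    by_cases hij : i = j
    · simp [hij]
    · simpa [hij] using h i j hij
  filter_upwards [h'] with e he i j hij
  by_contra hne
  exact he i j hne hij

theorem exists_measure_weightedSpacing (n : ℕ) :
    ∃ c : ℝ≥0∞, ∀ B : Set (Fin n → ℝ), MeasurableSet B →
      Measure.pi (fun _ : Fin n => expMeasure 1) (weightedSpacing n ⁻¹' (posOrthant n ∩ B)) =
        c * Measure.pi (fun _ : Fin n => expMeasure 1) B := by
  refine ⟨ENNReal.ofReal |(LinearMap.det (weightedSpacing n))⁻¹|, fun B hB => ?_⟩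
  have hpB := (measurableSet_posOrthant n).inter hB
  have hg : Measurable fun x : Fin n → ℝ => ∏ i, exponentialPDF 1 (x i) := by
    unfold exponentialPDF
    fun_prop
  have hB' : Measure.pi (fun _ : Fin n => expMeasure 1) B =
      Measure.pi (fun _ : Fin n => expMeasure 1) (posOrthant n ∩ B) := by
    refine measure_congr ?_
    filter_upwards [ae_pi_expMeasure_mem_posOrthant n] with e he
    exact propext ⟨fun h => ⟨he, h⟩, fun h => h.2⟩
  rw [hB', pi_expMeasure_eq, withDensity_apply _ (measurable_weightedSpacing n hpB),
    withDensity_apply _ hpB, ← smul_eq_mul,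
    ← lintegral_smul_measure, ← Measure.restrict_smul,
    ← Real.map_linearMap_volume_pi_eq_smul_volume_pi (det_weightedSpacing_ne_zero n),
    setLIntegral_map hpB hg (measurable_weightedSpacing n)]
  refine setLIntegral_congr_fun (measurable_weightedSpacing n hpB) fun e he => ?_
  have h1 : ∀ i, 0 < weightedSpacing n e i := he.1
  have h2 := ((weightedSpacing_pos_iff e).1 h1).2
  rw [prod_exponentialPDF_of_nonneg fun i => (h2 i).le,
    prod_exponentialPDF_of_nonneg fun i => (h1 i).le, sum_weightedSpacing]

/-- The decreasing rearrangement of a tuple. -/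
noncomputable def antitoneSort (e : Fin n → ℝ) : Fin n → ℝ := e ∘ Tuple.sort fun i => -e i

theorem antitone_antitoneSort (e : Fin n → ℝ) : Antitone (antitoneSort e) := fun i j hij => by
  have := Tuple.monotone_sort (fun i => -e i) hij
  simpa [antitoneSort] using this

theorem comp_eq_antitoneSort {e : Fin n → ℝ} {τ : Equiv.Perm (Fin n)} (h : Antitone (e ∘ τ)) :
    e ∘ τ = antitoneSort e :=
  Tuple.unique_antitone h (antitone_antitoneSort e)

theorem measurable_antitoneSort (n : ℕ) : Measurable (antitoneSort (n := n)) := by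
  let _ : MeasurableSpace (Equiv.Perm (Fin n)) := ⊤
  have hs : Measurable fun e : Fin n → ℝ => Tuple.sort fun i => -e i := by
    refine measurable_to_countable' fun τ => ?_
    have : (fun e : Fin n → ℝ => Tuple.sort fun i => -e i) ⁻¹' {τ} =
        {e | (∀ i j, i ≤ j → -e (τ i) ≤ -e (τ j)) ∧
          ∀ i j, i < j → -e (τ i) = -e (τ j) → τ i < τ j} := by
      ext e
      rw [Set.mem_preimage, Set.mem_singleton_iff, eq_comm, Tuple.eq_sort_iff]
      rfl
    rw [this]
    have hm (i : Fin n) : Measurable fun e : Fin n → ℝ => -e i := by fun_prop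
    refine MeasurableSet.inter (s₁ := {e : Fin n → ℝ | ∀ i j, i ≤ j → -e (τ i) ≤ -e (τ j)})
      (s₂ := {e : Fin n → ℝ | ∀ i j, i < j → -e (τ i) = -e (τ j) → τ i < τ j}) ?_ ?_
    · exact measurableSet_setOfPred.2 <| .forall fun i => .forall fun j =>
        measurable_const.imp (measurableSet_setOfPred.1 (measurableSet_le (hm _) (hm _)))
    · exact measurableSet_setOfPred.2 <| .forall fun i => .forall fun j => measurable_const.imp <|
        (measurableSet_setOfPred.1 (measurableSet_eq_fun (hm _) (hm _))).imp measurable_const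
  have hF : Measurable fun p : (Fin n → ℝ) × Equiv.Perm (Fin n) => p.1 ∘ p.2 := by
    refine measurable_from_prod_countable_left fun τ => ?_
    exact measurable_pi_lambda _ fun i => measurable_pi_apply (τ i)
  exact hF.comp (measurable_id.prodMk hs)

/-- Rényi's representation: the weighted spacings of the decreasing order statistics of
i.i.d. standard exponential variables are i.i.d. standard exponential. -/
theorem measurePreserving_weightedSpacing_antitoneSort (n : ℕ) :
    MeasurePreserving (fun e => weightedSpacing n (antitoneSort e))
      (Measure.pi fun _ : Fin n => expMeasure 1) (Measure.pi fun _ : Fin n => expMeasure 1) := by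
  have hS : Measurable fun e => weightedSpacing n (antitoneSort e) :=
    (measurable_weightedSpacing n).comp (measurable_antitoneSort n)
  refine ⟨hS, ?_⟩
  obtain ⟨c, hc⟩ := exists_measure_weightedSpacing n
  have hperm (τ : Equiv.Perm (Fin n)) :
      MeasurePreserving (fun e : Fin n → ℝ => e ∘ τ)
        (Measure.pi fun _ : Fin n => expMeasure 1) (Measure.pi fun _ : Fin n => expMeasure 1) := by
    convert! measurePreserving_piCongrLeft (fun _ : Fin n => expMeasure 1) τ.symm using 1
    ext e i
    simp [MeasurableEquiv.piCongrLeft, Equiv.piCongrLeft, Equiv.piCongrLeft']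
  let A (B : Set (Fin n → ℝ)) (τ : Equiv.Perm (Fin n)) : Set (Fin n → ℝ) :=
    (fun e => e ∘ τ) ⁻¹' (weightedSpacing n ⁻¹' (posOrthant n ∩ B))
  have hA (B) (hB : MeasurableSet B) (τ) : MeasurableSet (A B τ) :=
    (hperm τ).measurable (measurable_weightedSpacing n ((measurableSet_posOrthant n).inter hB))
  have hdisj (B) : Pairwise (Function.onFun Disjoint (A B)) := by
    intro τ τ' hne
    refine Set.disjoint_left.2 fun e h h' => hne ?_
    have h1 := ((weightedSpacing_pos_iff _).1 h.1).1
    have h2 := ((weightedSpacing_pos_iff _).1 h'.1).1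
    have h3 := Tuple.unique_antitone h1.antitone h2.antitone
    have hinj : Function.Injective e := by
      have := h1.injective.comp τ.symm.injective
      simpa [Function.comp_assoc] using this
    ext i
    exact congrArg Fin.val (hinj (congrFun h3 i))
  have hmap (B) (hB : MeasurableSet B) :
      (Measure.pi fun _ : Fin n => expMeasure 1).map
        (fun e => weightedSpacing n (antitoneSort e)) B =
      (Fintype.card (Equiv.Perm (Fin n)) * c) * Measure.pi (fun _ : Fin n => expMeasure 1) B := by
    rw [Measure.map_apply hS hB]
    have hcov : (fun e => weightedSpacing n (antitoneSort e)) ⁻¹' B =ᵐ[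
        Measure.pi fun _ : Fin n => expMeasure 1] ⋃ τ, A B τ := by
      filter_upwards [ae_pi_expMeasure_mem_posOrthant n, ae_pi_expMeasure_injective n] with e h0 hi
      refine propext ⟨fun h => ?_, fun h => ?_⟩
      · refine Set.mem_iUnion.2 ⟨Tuple.sort fun i => -e i, ?_, h⟩
        refine (weightedSpacing_pos_iff (antitoneSort e)).2 ⟨?_, fun i => h0 _⟩
        exact (antitone_antitoneSort e).strictAnti_of_injective
          (hi.comp (Tuple.sort _).injective)
      · obtain ⟨τ, h1, h2⟩ := Set.mem_iUnion.1 h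
        have := comp_eq_antitoneSort ((weightedSpacing_pos_iff _).1 h1).1.antitone
        change weightedSpacing n (antitoneSort e) ∈ B
        rw [← this]
        exact h2
    rw [measure_congr hcov, measure_iUnion (hdisj B) (hA B hB), tsum_fintype]
    have (τ : Equiv.Perm (Fin n)) : Measure.pi (fun _ : Fin n => expMeasure 1) (A B τ) =
        c * Measure.pi (fun _ : Fin n => expMeasure 1) B := by
      rw [← hc B hB]
      exact (hperm τ).measure_preimage
        (measurable_weightedSpacing n
          ((measurableSet_posOrthant n).inter hB)).nullMeasurableSet
    simp [this, mul_assoc]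
  have h1 : (Fintype.card (Equiv.Perm (Fin n)) * c) = 1 := by
    have := hmap Set.univ MeasurableSet.univ
    rw [Measure.map_apply hS MeasurableSet.univ] at this
    simpa using this.symm
  ext B hB
  rw [hmap B hB, h1, one_mul]

/-- The standard normal distribution function. -/
local notation "Φ" => cdf (gaussianReal 0 1)

theorem cdf_gaussian_pos (x : ℝ) : 0 < Φ x := by
  have h : (gaussianReal 0 1) (Set.Iic x) ≠ 0 := fun h => by
    have := gaussianReal_absolutelyContinuous' 0 (one_ne_zero) h
    simp at this
  rw [← ofReal_cdf] at h
  simpa using h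

theorem cdf_gaussian_lt_one (x : ℝ) : Φ x < 1 := by
  have h : (gaussianReal 0 1) (Set.Ioi x) ≠ 0 := fun h => by
    have := gaussianReal_absolutelyContinuous' 0 (one_ne_zero) h
    simp at this
  have h2 := prob_add_prob_compl (μ := gaussianReal 0 1) (measurableSet_Iic (a := x))
  rw [Set.compl_Iic, ← ofReal_cdf] at h2
  refine lt_of_le_of_ne (cdf_le_one _ _) fun h3 => h ?_
  rw [h3, ENNReal.ofReal_one] at h2
  simpa using h2

theorem continuous_cdf_gaussian : Continuous Φ := by
  refine continuous_iff_continuousAt.2 fun x => ?_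
  have := nullSingletonClass_gaussianReal (μ := 0) (v := 1) one_ne_zero
  rw [(monotone_cdf _).continuousAt_iff_leftLim_eq_rightLim, StieltjesFunction.rightLim_eq]
  have h : (Φ).measure {x} = 0 := by
    rw [measure_cdf]
    exact measure_singleton x
  rw [StieltjesFunction.measure_singleton, ENNReal.ofReal_eq_zero, sub_nonpos] at h
  exact le_antisymm ((monotone_cdf _).leftLim_le le_rfl) h

theorem exists_cdf_gaussian_eq {u : ℝ} (h0 : 0 < u) (h1 : u < 1) : ∃ x, Φ x = u := by
  have ha := ((tendsto_cdf_atBot (gaussianReal 0 1)).eventually (gt_mem_nhds h0)).exists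
  have hb := ((tendsto_cdf_atTop (gaussianReal 0 1)).eventually (lt_mem_nhds h1)).exists
  obtain ⟨a, ha⟩ := ha
  obtain ⟨b, hb⟩ := hb
  exact mem_range_of_exists_le_of_exists_ge continuous_cdf_gaussian ⟨a, ha.le⟩ ⟨b, hb.le⟩

theorem strictMono_cdf_gaussian : StrictMono Φ := by
  intro a b hab
  have h : (gaussianReal 0 1) (Set.Ioc a b) ≠ 0 := fun h => by
    have := gaussianReal_absolutelyContinuous' 0 (one_ne_zero) h
    simp at this
    linarith
  refine lt_of_le_of_ne (monotone_cdf _ hab.le) fun h3 => h ?_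
  rw [← measure_cdf (gaussianReal 0 1), StieltjesFunction.measure_Ioc, h3, sub_self,
    ENNReal.ofReal_zero]

/-- The probability integral transform: `- log Φ(X)` is standard exponential. -/
theorem map_neg_log_cdf_gaussian :
    (gaussianReal 0 1).map (fun x => -Real.log (Φ x)) = expMeasure 1 := by
  have hm : Measurable fun x => -Real.log (Φ x) :=
    (Real.measurable_log.comp continuous_cdf_gaussian.measurable).neg
  have := Measure.isProbabilityMeasure_map (μ := gaussianReal 0 1) hm.aemeasurable
  refine Measure.eq_of_cdf _ _ (StieltjesFunction.ext fun t => ?_)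
  rw [cdf_expMeasure_eq one_pos, cdf_eq_real, map_measureReal_apply hm measurableSet_Iic]
  split_ifs with ht
  · rcases ht.eq_or_lt with rfl | ht
    · have : (fun x => -Real.log (Φ x)) ⁻¹' Set.Iic 0 = ∅ := by
        ext x
        simp [Real.log_neg (cdf_gaussian_pos x) (cdf_gaussian_lt_one x)]
      simp [this]
    · obtain ⟨q, hq⟩ := exists_cdf_gaussian_eq (Real.exp_pos (-t)) (by simpa using ht)
      have : (fun x => -Real.log (Φ x)) ⁻¹' Set.Iic t = Set.Ici q := by
        ext x
        rw [Set.mem_preimage, Set.mem_Iic, Set.mem_Ici, neg_le,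
          Real.le_log_iff_exp_le (cdf_gaussian_pos x), ← hq, strictMono_cdf_gaussian.le_iff_le]
      have hn := nullSingletonClass_gaussianReal (μ := 0) (v := 1) one_ne_zero
      rw [this, ← Set.compl_Iio, measureReal_compl measurableSet_Iio,
        measureReal_congr (Iio_ae_eq_Iic (μ := gaussianReal 0 1)), ← cdf_eq_real, hq]
      simp
  · have : (fun x => -Real.log (Φ x)) ⁻¹' Set.Iic t = ∅ := by
      ext x
      have := Real.log_neg (cdf_gaussian_pos x) (cdf_gaussian_lt_one x)
      simp only [Set.mem_preimage, Set.mem_Iic, Set.mem_empty_iff_false, iff_false]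
      linarith
    simp [this]

/-- Gaussian left tails decay at least exponentially, at a rate given by the right end point. -/
theorem cdf_gaussian_le_mul_exp {a b : ℝ} (hab : a ≤ b) :
    Φ a ≤ Φ b * Real.exp (b * (b - a)) := by
  have h1 (x : ℝ) : Φ x = ∫ t in Set.Iic x, gaussianPDFReal 0 1 t := by
    rw [cdf_eq_real, measureReal_def, gaussianReal_apply_eq_integral _ one_ne_zero,
      ENNReal.toReal_ofReal (integral_nonneg fun _ => gaussianPDFReal_nonneg _ _ _)]
  have hshift : ∫ t in Set.Iic a, gaussianPDFReal 0 1 t =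
      ∫ t in Set.Iic b, gaussianPDFReal 0 1 (t - (b - a)) := by
    have := (measurePreserving_sub_right (volume : Measure ℝ) (b - a)).setIntegral_preimage_emb
      (MeasurableEquiv.subRight (b - a)).measurableEmbedding (gaussianPDFReal 0 1) (Set.Iic a)
    rw [← this]
    congr 2
    ext x
    simp
  rw [h1, h1, hshift, ← integral_mul_const]
  refine setIntegral_mono_on ?_ ?_ measurableSet_Iic fun t ht => ?_
  · exact ((integrable_gaussianPDFReal 0 1).comp_sub_right (b - a)).integrableOn
  · exact ((integrable_gaussianPDFReal 0 1).mul_const _).integrableOn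
  · have ht : t ≤ b := ht
    rw [gaussianPDFReal, gaussianPDFReal, mul_assoc _ (Real.exp _), ← Real.exp_add]
    have : -(t - (b - a) - 0) ^ 2 / (2 * ((1 : ℝ≥0) : ℝ)) ≤
        -(t - 0) ^ 2 / (2 * ((1 : ℝ≥0) : ℝ)) + b * (b - a) := by
      simp only [NNReal.coe_one]
      nlinarith [mul_nonneg (sub_nonneg.2 ht) (sub_nonneg.2 hab)]
    gcongr

/-- A lower bound for Gaussian left tails. -/
theorem le_cdf_gaussian {a : ℝ} (ha : 0 ≤ a) :
    (√(2 * Real.pi))⁻¹ * Real.exp (-(a + 1) ^ 2 / 2) ≤ Φ (-a) := by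
  have h1 : Φ (-a) = ∫ t in Set.Iic (-a), gaussianPDFReal 0 1 t := by
    rw [cdf_eq_real, measureReal_def, gaussianReal_apply_eq_integral _ one_ne_zero,
      ENNReal.toReal_ofReal (integral_nonneg fun _ => gaussianPDFReal_nonneg _ _ _)]
  rw [h1]
  calc _ = ∫ t in Set.Icc (-a - 1) (-a), (√(2 * Real.pi))⁻¹ * Real.exp (-(a + 1) ^ 2 / 2) := by
        simp
    _ ≤ ∫ t in Set.Icc (-a - 1) (-a), gaussianPDFReal 0 1 t := by
        refine setIntegral_mono_on (integrableOn_const (by simp))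
          (integrable_gaussianPDFReal 0 1).integrableOn measurableSet_Icc fun t ht => ?_
        rw [gaussianPDFReal]
        simp only [NNReal.coe_one, mul_one, sub_zero]
        have : t ^ 2 ≤ (a + 1) ^ 2 := by
          rw [sq_le_sq, abs_of_nonneg (by linarith : 0 ≤ a + 1), abs_le]
          exact ⟨by linarith [ht.1], by linarith [ht.2]⟩
        gcongr
    _ ≤ _ := setIntegral_mono_set (integrable_gaussianPDFReal 0 1).integrableOn
        (ae_of_all _ fun _ => gaussianPDFReal_nonneg _ _ _) Set.Icc_subset_Iic_self.eventuallyLE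

/-- The exponential energies `- log Φ(h(σ) / √N)`, enumerated by `enum`. -/
noncomputable def expEnergy {N : ℕ} (h : Config N → ℝ) (k : Fin (2 ^ N)) : ℝ :=
  -Real.log (Φ (h (enum N k) / √N))

theorem measurable_expEnergy_coord (N : ℕ) :
    Measurable fun x : ℝ => -Real.log (Φ (x / √N)) :=
  (Real.measurable_log.comp
    (continuous_cdf_gaussian.measurable.comp (measurable_id.div_const _))).neg

theorem measurable_expEnergy (N : ℕ) : Measurable (expEnergy (N := N)) :=
  measurable_pi_lambda _ fun _ => (measurable_expEnergy_coord N).comp (measurable_pi_apply _)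

theorem antitoneSort_expEnergy {N : ℕ} (h : Config N → ℝ) (k : Fin (2 ^ N)) :
    antitoneSort (expEnergy h) k = -Real.log (Φ (h (sortedConfig h k) / √N)) := by
  have hanti : Antitone (expEnergy h ∘ Tuple.sort (h ∘ enum N)) := fun i j hij => by
    have := Tuple.monotone_sort (h ∘ enum N) hij
    refine neg_le_neg (Real.log_le_log (cdf_gaussian_pos _) (monotone_cdf _ ?_))
    exact div_le_div_of_nonneg_right this (Real.sqrt_nonneg _)
  exact (congrFun (comp_eq_antitoneSort hanti) k).symm

theorem uniformOrderStat_succ_pos {N : ℕ} (h : Config N → ℝ) (k : ℕ) :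
    0 < uniformOrderStat h (k + 1) := by
  rw [uniformOrderStat, if_neg k.succ_ne_zero]
  split_ifs
  · exact cdf_gaussian_pos _
  · exact one_pos

theorem uniformOrderStat_succ {N : ℕ} (h : Config N → ℝ) (k : Fin (2 ^ N)) :
    uniformOrderStat h (k + 1) = Φ (h (sortedConfig h k) / √N) := by
  rw [uniformOrderStat, if_neg (Nat.succ_ne_zero _), dif_pos (by simp)]
  simp

theorem log_uniformOrderStat_succ {N : ℕ} (h : Config N → ℝ) (k : ℕ) :
    Real.log (uniformOrderStat h (k + 1)) = -extendZero (antitoneSort (expEnergy h)) k := by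
  by_cases hk : k < 2 ^ N
  · have := uniformOrderStat_succ h ⟨k, hk⟩
    simp only at this
    rw [this, extendZero, dif_pos hk, antitoneSort_expEnergy, neg_neg]
  · rw [extendZero, dif_neg hk, uniformOrderStat, if_neg k.succ_ne_zero,
      dif_neg (by simpa using hk)]
    simp

theorem spacing_succ {N : ℕ} (h : Config N → ℝ) (i : Fin (2 ^ N)) :
    spacing h (i + 1) = weightedSpacing (2 ^ N) (antitoneSort (expEnergy h)) i := by
  rw [spacing, Real.log_div (uniformOrderStat_succ_pos h _).ne' (uniformOrderStat_succ_pos h _).ne',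
    log_uniformOrderStat_succ, log_uniformOrderStat_succ, weightedSpacing_apply]
  push_cast
  ring

/-- All the spacings of a volume. -/
noncomputable def spacings {N : ℕ} (h : Config N → ℝ) (i : Fin (2 ^ N)) : ℝ := spacing h (i + 1)

theorem spacings_eq {N : ℕ} (h : Config N → ℝ) :
    spacings h = weightedSpacing (2 ^ N) (antitoneSort (expEnergy h)) :=
  funext (spacing_succ h)

theorem measurable_spacings (N : ℕ) : Measurable (spacings (N := N)) := by
  have : spacings (N := N) = fun h => weightedSpacing (2 ^ N) (antitoneSort (expEnergy h)) :=
    funext spacings_eq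
  rw [this]
  exact (measurable_weightedSpacing _).comp
    ((measurable_antitoneSort _).comp (measurable_expEnergy N))

theorem gaussianReal_map_div_sqrt {N : ℕ} (hN : 1 ≤ N) :
    (gaussianReal 0 (N : ℝ≥0)).map (· / √(N : ℝ)) = gaussianReal 0 1 := by
  rw [gaussianReal_map_div_const, zero_div]
  congr 1
  have hN' : ((N : ℝ≥0)) ≠ 0 := by positivity
  have : (NNReal.mk (√(N : ℝ) ^ 2) (sq_nonneg _)) = (N : ℝ≥0) :=
    NNReal.eq (by simp)
  rw [this, div_self hN']

theorem map_expEnergy_coord {N : ℕ} (hN : 1 ≤ N) :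
    (gaussianReal 0 (N : ℝ≥0)).map (fun x => -Real.log (Φ (x / √N))) = expMeasure 1 := by
  have h2 := Measure.map_map (μ := gaussianReal 0 (N : ℝ≥0)) (f := (· / √(N : ℝ)))
    (Real.measurable_log.comp continuous_cdf_gaussian.measurable).neg (measurable_id.div_const _)
  rw [gaussianReal_map_div_sqrt hN] at h2
  exact h2.symm.trans map_neg_log_cdf_gaussian

variable {Ω : Type*} [MeasurableSpace Ω] {P : Measure Ω}

/-- The spacings of a sample of `2 ^ N` i.i.d. Gaussians of variance `N` are i.i.d. standard
exponential. -/
theorem hasLaw_spacings {N : ℕ} (hN : 1 ≤ N) {X : Ω → Config N → ℝ}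
    (hlaw : ∀ σ, HasLaw (fun ω => X ω σ) (gaussianReal 0 (N : ℝ≥0)) P)
    (hind : iIndepFun (fun σ ω => X ω σ) P) :
    HasLaw (fun ω => spacings (X ω)) (Measure.pi fun _ : Fin (2 ^ N) => expMeasure 1) P := by
  have hE : HasLaw (fun ω => expEnergy (X ω))
      (Measure.pi fun _ : Fin (2 ^ N) => expMeasure 1) P := by
    refine iIndepFun.hasLaw_pi (X := fun k ω => expEnergy (X ω) k) (fun k => ?_) ?_
    · exact HasLaw.comp (Y := fun x => -Real.log (Φ (x / √N)))
        ⟨(measurable_expEnergy_coord N).aemeasurable, map_expEnergy_coord hN⟩ (hlaw (enum N k))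
    · exact (hind.precomp (enum N).injective).comp _ fun _ => measurable_expEnergy_coord N
  have := (measurePreserving_weightedSpacing_antitoneSort (2 ^ N)).hasLaw.comp hE
  simpa only [Function.comp_def, ← spacings_eq] using this

theorem HasLaw.eval_of_pi [IsProbabilityMeasure P] {n : ℕ} {Y : Ω → Fin n → ℝ}
    (hY : HasLaw Y (Measure.pi fun _ : Fin n => expMeasure 1) P) :
    (∀ i, HasLaw (fun ω => Y ω i) (expMeasure 1) P) ∧ iIndepFun (fun i ω => Y ω i) P := by
  have h1 (i) : HasLaw (fun ω => Y ω i) (expMeasure 1) P :=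
    (measurePreserving_eval (fun _ : Fin n => expMeasure 1) i).hasLaw.comp hY
  exact ⟨h1, (iIndepFun_iff_hasLaw_pi_pi h1).2 hY⟩

theorem spacing_hasLaw_and_iIndepFun [IsProbabilityMeasure P]
    {H : (N : ℕ) → Ω → Config N → ℝ} (hH : IsREM P H)
    {N : ℕ} (hN : 1 ≤ N) :
    (∀ i, 1 ≤ i → i ≤ 2 ^ N → HasLaw (fun ω => spacing (H N ω) i) (expMeasure 1) P) ∧
      iIndepFun (fun (i : Fin (2 ^ N)) ω => spacing (H N ω) (i + 1)) P := by
  have h := HasLaw.eval_of_pi (hasLaw_spacings hN (hH.law N hN) (hH.indep N hN))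
  refine ⟨fun i h1 h2 => ?_, h.2⟩
  obtain ⟨k, rfl⟩ := Nat.exists_eq_add_of_le' h1
  exact h.1 ⟨k, h2⟩

theorem RepresentedBy.hasLaw_and_iIndepFun [IsProbabilityMeasure P]
    {H : (N : ℕ) → Ω → Config N → ℝ} (hH : IsREM P H)
    {W : ℕ → Ω → ℝ} (hW : RepresentedBy P H W) :
    (∀ i, 1 ≤ i → HasLaw (W i) (expMeasure 1) P) ∧ iIndepFun (fun i : ℕ => W (i + 1)) P := by
  refine ⟨fun i hi => ?_, ?_⟩
  · have hle : i ≤ 2 ^ i := Nat.lt_two_pow_self.le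
    exact ((spacing_hasLaw_and_iIndepFun hH hi).1 i hi hle).congr
      ((hW i hi i hi hle).mono fun _ h => h.symm)
  · refine iIndepFun_iff_finset.2 fun s => ?_
    let N := s.sup id + 1
    have hlt (i : s) : (i : ℕ) < 2 ^ N :=
      ((Finset.le_sup (f := id) i.2).trans_lt (Nat.lt_succ_self _)).trans Nat.lt_two_pow_self
    have hN : 1 ≤ N := Nat.le_add_left _ _
    have h := (spacing_hasLaw_and_iIndepFun hH hN).2
    have h2 := h.precomp (g := fun i : s => (⟨i, hlt i⟩ : Fin (2 ^ N)))
      fun i j hij => Subtype.ext (congrArg Fin.val hij)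
    exact h2.congr fun i => hW N hN _ (Nat.le_add_left _ _) (hlt i)

/-- The configuration of second lowest energy. -/
noncomputable def secondConfig {N : ℕ} (hN : 1 ≤ N) (h : Config N → ℝ) : Config N :=
  sortedConfig h ⟨1, Nat.one_lt_two_pow (by omega)⟩

theorem minConfig_ne_secondConfig {N : ℕ} (hN : 1 ≤ N) (h : Config N → ℝ) :
    minConfig h ≠ secondConfig hN h := by
  rw [minConfig, secondConfig]
  simp

theorem secondConfig_le {N : ℕ} (hN : 1 ≤ N) (h : Config N → ℝ) {σ : Config N}
    (hσ : σ ≠ minConfig h) : h (secondConfig hN h) ≤ h σ := by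
  have h0 : (sortedConfig h).symm σ ≠ ⟨0, by positivity⟩ := by
    rwa [Ne, Equiv.symm_apply_eq]
  have := monotone_sortedConfig h (a := ⟨1, Nat.one_lt_two_pow (by omega)⟩)
    (b := (sortedConfig h).symm σ)
    (Fin.mk_le_of_le_val (Nat.one_le_iff_ne_zero.2 fun h1 => h0 (Fin.ext h1)))
  simpa [secondConfig] using this

section Gibbs

variable {N : ℕ}

theorem gibbs_toReal (β : ℝ) (h : Config N → ℝ) (σ : Config N) :
    (gibbs β h σ).toReal = Real.exp (-β * h σ) / partitionFunction β h := by
  rw [gibbs, PMF.ofFintype_apply, ENNReal.toReal_ofReal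
    (div_nonneg (Real.exp_pos _).le (partitionFunction_pos β h).le)]

theorem gibbs_ne_pure (hN : 1 ≤ N) (β : ℝ) (h : Config N → ℝ) :
    gibbs β h ≠ PMF.pure (minConfig h) := fun heq => by
  have h1 := gibbs_toReal β h (secondConfig hN h)
  rw [heq, PMF.pure_apply_of_ne _ _ (minConfig_ne_secondConfig hN h).symm] at h1
  exact (div_pos (Real.exp_pos _) (partitionFunction_pos β h)).ne h1

theorem sum_toReal_pmf (μ : PMF (Config N)) : ∑ σ, (μ σ).toReal = 1 := by
  rw [← ENNReal.toReal_sum fun σ _ => μ.apply_ne_top σ, ← tsum_fintype (L := .unconditional _),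
    μ.tsum_coe, ENNReal.toReal_one]

theorem abs_expect_le (μ : PMF (Config N)) (Ψ : Config N → ℝ) : |expect μ Ψ| ≤ ‖Ψ‖ := by
  calc |expect μ Ψ| ≤ ∑ σ, |Ψ σ * (μ σ).toReal| := Finset.abs_sum_le_sum_abs _ _
    _ ≤ ∑ σ, ‖Ψ‖ * (μ σ).toReal := by
        refine Finset.sum_le_sum fun σ _ => ?_
        rw [abs_mul, abs_of_nonneg (ENNReal.toReal_nonneg (a := μ σ))]
        exact mul_le_mul_of_nonneg_right (norm_le_pi_norm Ψ σ) ENNReal.toReal_nonneg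
    _ = ‖Ψ‖ := by rw [← Finset.mul_sum, sum_toReal_pmf, mul_one]

theorem abs_expect_sub_le (μ ν : PMF (Config N)) {Ψ : Config N → ℝ} (hΨ : ‖Ψ‖ = 1) :
    |expect μ Ψ - expect ν Ψ| ≤ 2 := by
  have h1 := abs_expect_le μ Ψ
  have h2 := abs_expect_le ν Ψ
  rw [hΨ] at h1 h2
  linarith [abs_sub (expect μ Ψ) (expect ν Ψ)]

theorem abs_expect_sub_le_dTV (μ ν : PMF (Config N)) {Ψ : Config N → ℝ} (hΨ : ‖Ψ‖ = 1) :
    |expect μ Ψ - expect ν Ψ| ≤ dTV μ ν :=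
  le_csSup ⟨2, by rintro _ ⟨Ψ, hΨ, rfl⟩; exact abs_expect_sub_le μ ν hΨ⟩ ⟨Ψ, hΨ, rfl⟩

theorem dTV_le_two (μ ν : PMF (Config N)) : dTV μ ν ≤ 2 :=
  Real.sSup_le (by rintro _ ⟨Ψ, hΨ, rfl⟩; exact abs_expect_sub_le μ ν hΨ) zero_le_two

theorem one_sub_le_dTV_pure (μ : PMF (Config N)) (σ : Config N) :
    1 - (μ σ).toReal ≤ dTV μ (PMF.pure σ) := by
  have hn : ‖(Pi.single σ 1 : Config N → ℝ)‖ = 1 := by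
    rw [Pi.norm_single]
    simp
  have h := abs_expect_sub_le_dTV μ (PMF.pure σ) (Ψ := Pi.single σ 1) hn
  have he (ν : PMF (Config N)) : expect ν (Pi.single σ 1) = (ν σ).toReal := by
    simp [expect, Pi.single_apply]
  rw [he, he, PMF.pure_apply_self, ENNReal.toReal_one] at h
  linarith [neg_abs_le ((μ σ).toReal - 1)]

/-- The Gibbs measure keeps at least the mass of a two-level system away from the minimum. -/
theorem inv_one_add_exp_le_dTV (hN : 1 ≤ N) (β : ℝ) (h : Config N → ℝ) :
    (1 + Real.exp (β * (h (secondConfig hN h) - h (minConfig h))))⁻¹ ≤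
      dTV (gibbs β h) (PMF.pure (minConfig h)) := by
  refine le_trans ?_ (one_sub_le_dTV_pure _ _)
  rw [gibbs_toReal]
  set a := Real.exp (-β * h (minConfig h)) with ha
  set b := Real.exp (-β * h (secondConfig hN h)) with hb
  have hZ : a + b ≤ partitionFunction β h := by
    rw [partitionFunction, ← Finset.sum_pair (f := fun σ => Real.exp (-β * h σ))
      (minConfig_ne_secondConfig hN h)]
    exact Finset.sum_le_sum_of_subset_of_nonneg (Finset.subset_univ _)
      fun _ _ _ => (Real.exp_pos _).le
  have ha0 : 0 < a := Real.exp_pos _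
  have hb0 : 0 < b := Real.exp_pos _
  have hab : Real.exp (β * (h (secondConfig hN h) - h (minConfig h))) = a / b := by
    rw [ha, hb, ← Real.exp_sub]
    ring_nf
  have h1 : a / partitionFunction β h ≤ a / (a + b) := by gcongr
  have h2 : (1 + a / b)⁻¹ = 1 - a / (a + b) := by
    field_simp
    ring
  rw [hab, h2]
  linarith

end Gibbs

theorem spacing_nonneg {N : ℕ} (h : Config N → ℝ) (k : ℕ) : 0 ≤ spacing h (k + 1) := by
  refine mul_nonneg (Nat.cast_nonneg _) (Real.log_nonneg ?_)
  rw [one_le_div (uniformOrderStat_succ_pos h k)]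
  by_cases h2 : k + 1 < 2 ^ N
  · have e1 := uniformOrderStat_succ h ⟨k, by omega⟩
    have e2 := uniformOrderStat_succ h ⟨k + 1, h2⟩
    simp only at e1 e2
    rw [e1, e2]
    refine monotone_cdf _ <|
      div_le_div_of_nonneg_right (monotone_sortedConfig h ?_) (Real.sqrt_nonneg _)
    exact Fin.mk_le_mk.2 k.le_succ
  · have : uniformOrderStat h (k + 1 + 1) = 1 := by
      rw [uniformOrderStat, if_neg (Nat.succ_ne_zero _), dif_neg (by simpa using h2)]
    rw [this, uniformOrderStat, if_neg (Nat.succ_ne_zero _)]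
    split_ifs
    · exact cdf_le_one _ _
    · exact le_rfl

/-- The first spacing controls the energy gap. -/
theorem mul_gap_le_spacing_one {N : ℕ} (hN : 1 ≤ N) (h : Config N → ℝ) {l : ℝ}
    (hl : h (secondConfig hN h) ≤ -l * N) :
    l * (h (secondConfig hN h) - h (minConfig h)) ≤ spacing h 1 := by
  have h0 : 0 < √(N : ℝ) := Real.sqrt_pos.2 (by exact_mod_cast hN)
  have hle := minConfig_le h (secondConfig hN h)
  have e1 := uniformOrderStat_succ h ⟨0, by positivity⟩
  have e2 := uniformOrderStat_succ h ⟨1, Nat.one_lt_two_pow (by omega)⟩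
  simp only at e1 e2
  have hs : spacing h 1 = Real.log (Φ (h (secondConfig hN h) / √N)) -
      Real.log (Φ (h (minConfig h) / √N)) := by
    rw [spacing, Nat.cast_one, one_mul, Real.log_div (uniformOrderStat_succ_pos h 1).ne'
      (uniformOrderStat_succ_pos h 0).ne']
    rw [show (1 : ℕ) = 0 + 1 from rfl, e1, show 0 + 1 + 1 = 1 + 1 from rfl, e2]
    rfl
  have hcdf := Real.log_le_log (cdf_gaussian_pos _)
    (cdf_gaussian_le_mul_exp (div_le_div_of_nonneg_right hle h0.le))
  rw [Real.log_mul (cdf_gaussian_pos _).ne' (Real.exp_pos _).ne', Real.log_exp] at hcdf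
  have hd : h (secondConfig hN h) / √N *
      (h (secondConfig hN h) / √N - h (minConfig h) / √N) =
      h (secondConfig hN h) / N * (h (secondConfig hN h) - h (minConfig h)) := by
    rw [← sub_div, div_mul_div_comm, Real.mul_self_sqrt (Nat.cast_nonneg _)]
    ring
  have hx : h (secondConfig hN h) / N ≤ -l := by
    rwa [div_le_iff₀ (by exact_mod_cast hN)]
  have := mul_le_mul_of_nonneg_right hx (sub_nonneg.2 hle)
  rw [hs]
  linarith

theorem inv_one_add_exp_sub_le {s t : ℝ} (ht : 1 ≤ t) :
    (1 + Real.exp s)⁻¹ - (t - 1) ≤ (1 + Real.exp (t * s))⁻¹ := by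
  have hexp : 0 < Real.exp s := Real.exp_pos s
  have hexp' : 0 < Real.exp (t * s) := Real.exp_pos _
  have h1 : (1 + Real.exp s)⁻¹ - (1 + Real.exp (t * s))⁻¹ =
      (Real.exp (t * s) - Real.exp s) / ((1 + Real.exp s) * (1 + Real.exp (t * s))) := by
    field_simp
    ring
  have h2 : Real.exp (t * s) - Real.exp s ≤ (t - 1) * s * Real.exp (t * s) := by
    have h3 := Real.add_one_le_exp (-((t - 1) * s))
    have h4 : Real.exp s = Real.exp (t * s) * Real.exp (-((t - 1) * s)) := by
      rw [← Real.exp_add]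
      ring_nf
    rw [h4]
    nlinarith
  have h5 : s ≤ 1 + Real.exp s := by linarith [Real.add_one_le_exp s]
  have h6 : (Real.exp (t * s) - Real.exp s) / ((1 + Real.exp s) * (1 + Real.exp (t * s))) ≤
      t - 1 := by
    rw [div_le_iff₀ (by positivity)]
    calc _ ≤ (t - 1) * s * Real.exp (t * s) := h2
      _ ≤ (t - 1) * (1 + Real.exp s) * (1 + Real.exp (t * s)) := by
        have : 0 ≤ t - 1 := by linarith
        gcongr
        linarith
      _ = _ := by ring
  linarith

theorem betaC_pos : 0 < betaC := Real.sqrt_pos.2 (by positivity)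

theorem lowerBound_eq (β w₁ w₂ : ℝ) :
    lowerBound β w₁ w₂ = (1 + Real.exp (β / betaC * (w₁ + w₂ / 2)))⁻¹ := by
  rw [lowerBound, neg_mul, Real.exp_neg]
  have := Real.exp_pos (β / betaC * (w₁ + w₂ / 2))
  field_simp
  ring

theorem lowerBound_pos (β w₁ w₂ : ℝ) : 0 < lowerBound β w₁ w₂ := by
  rw [lowerBound_eq]
  positivity

theorem lowerBound_sub_le_dTV {N : ℕ} (hN : 1 ≤ N) {β : ℝ} (hβ : 0 < β) (h : Config N → ℝ) {t : ℝ}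
    (ht : 1 ≤ t) (hl : h (secondConfig hN h) ≤ -(betaC / t) * N) :
    lowerBound β (spacing h 1) (spacing h 2) - (t - 1) ≤
      dTV (gibbs β h) (PMF.pure (minConfig h)) := by
  have hc := betaC_pos
  have hw1 : 0 ≤ spacing h 1 := spacing_nonneg h 0
  have hw2 : 0 ≤ spacing h 2 := spacing_nonneg h 1
  have hgap := mul_gap_le_spacing_one hN h hl
  have ht0 : 0 < t := by linarith
  have hβΔ : β * (h (secondConfig hN h) - h (minConfig h)) ≤ t * (β / betaC * spacing h 1) := by
    calc _ = t * (β / betaC * (betaC / t * (h (secondConfig hN h) - h (minConfig h)))) := by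
          field_simp
      _ ≤ _ := by gcongr
  refine le_trans ?_ (inv_one_add_exp_le_dTV hN β h)
  calc _ ≤ (1 + Real.exp (β / betaC * spacing h 1))⁻¹ - (t - 1) := by
        rw [lowerBound_eq]
        gcongr
        linarith
    _ ≤ (1 + Real.exp (t * (β / betaC * spacing h 1)))⁻¹ :=
        inv_one_add_exp_sub_le ht
    _ ≤ _ := by gcongr

theorem gaussianReal_Ioi_eq {N : ℕ} (hN : 1 ≤ N) (l : ℝ) :
    gaussianReal 0 (N : ℝ≥0) (Set.Ioi (-l * N)) = ENNReal.ofReal (1 - Φ (-(l * √N))) := by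
  have h0 : 0 < √(N : ℝ) := Real.sqrt_pos.2 (by exact_mod_cast hN)
  have hpre : (· / √(N : ℝ)) ⁻¹' Set.Ioi (-(l * √N)) = Set.Ioi (-l * N) := by
    ext x
    rw [Set.mem_preimage, Set.mem_Ioi, Set.mem_Ioi, lt_div_iff₀ h0, neg_mul, mul_assoc,
      Real.mul_self_sqrt (Nat.cast_nonneg _), neg_mul]
  have hm : Measurable (· / √(N : ℝ)) := measurable_id.div_const _
  rw [← hpre, ← Measure.map_apply hm measurableSet_Ioi, gaussianReal_map_div_sqrt hN,
    ← Set.compl_Iic, prob_compl_eq_one_sub measurableSet_Iic,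
    ← ofReal_cdf, ENNReal.ofReal_sub _ (cdf_nonneg _ _), ENNReal.ofReal_one]

theorem measure_second_lowest_gt_le {N : ℕ} (hN : 1 ≤ N) {X : Ω → Config N → ℝ}
    (hlaw : ∀ σ, HasLaw (fun ω => X ω σ) (gaussianReal 0 (N : ℝ≥0)) P)
    (hind : iIndepFun (fun σ ω => X ω σ) P) (l : ℝ) :
    P {ω | -l * N < X ω (secondConfig hN (X ω))} ≤
      ENNReal.ofReal (2 ^ N * Real.exp (-((2 ^ N - 1) * Φ (-(l * √N))))) := by
  set p := Φ (-(l * √N)) with hp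
  have hsub : {ω | -l * N < X ω (secondConfig hN (X ω))} ⊆
      ⋃ σ₀, ⋂ σ ∈ Finset.univ.erase σ₀, (fun ω => X ω σ) ⁻¹' Set.Ioi (-l * N) := by
    intro ω hω
    refine Set.mem_iUnion.2 ⟨minConfig (X ω), Set.mem_iInter₂.2 fun σ hσ => ?_⟩
    exact lt_of_lt_of_le hω (secondConfig_le hN (X ω) (Finset.ne_of_mem_erase hσ))
  have hone (σ₀ : Config N) :
      P (⋂ σ ∈ Finset.univ.erase σ₀, (fun ω => X ω σ) ⁻¹' Set.Ioi (-l * N)) ≤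
        ENNReal.ofReal (Real.exp (-((2 ^ N - 1) * p))) := by
    rw [hind.measure_inter_preimage_eq_mul _ fun _ _ => measurableSet_Ioi]
    have hσ (σ : Config N) : P ((fun ω => X ω σ) ⁻¹' Set.Ioi (-l * N)) =
        ENNReal.ofReal (1 - p) := by
      rw [← gaussianReal_Ioi_eq hN l, ← (hlaw σ).map_eq,
        Measure.map_apply_of_aemeasurable (hlaw σ).aemeasurable measurableSet_Ioi]
    have h1p : 0 ≤ 1 - p := sub_nonneg.2 (cdf_le_one _ _)
    rw [Finset.prod_congr rfl fun σ _ => hσ σ, Finset.prod_const,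
      Finset.card_erase_of_mem (Finset.mem_univ _), Finset.card_univ, card_config,
      ← ENNReal.ofReal_pow h1p]
    refine ENNReal.ofReal_le_ofReal ?_
    calc (1 - p) ^ (2 ^ N - 1) ≤ Real.exp (-p) ^ (2 ^ N - 1) :=
          pow_le_pow_left₀ h1p (Real.one_sub_le_exp_neg p) _
      _ = _ := by
          rw [← Real.exp_nat_mul, Nat.cast_sub Nat.one_le_two_pow]
          push_cast
          ring_nf
  calc _ ≤ P _ := measure_mono hsub
    _ ≤ ∑' σ₀ : Config N, P _ := measure_iUnion_le _
    _ ≤ ∑' _ : Config N, ENNReal.ofReal (Real.exp (-((2 ^ N - 1) * p))) :=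
        ENNReal.tsum_le_tsum hone
    _ = _ := by
        rw [tsum_fintype, Finset.sum_const, Finset.card_univ, card_config, nsmul_eq_mul,
          ENNReal.ofReal_mul (by positivity)]
        congr 1
        rw [ENNReal.ofReal_pow zero_le_two]
        simp

/-- Below the critical rate the expected number of low energies grows faster than linearly. -/
theorem eventually_le_expected_number {l : ℝ} (hl : 0 ≤ l) (hlc : l < betaC) :
    ∀ᶠ N : ℕ in atTop, 2 * Real.log 2 * N ≤ (2 ^ N - 1) * Φ (-(l * √N)) := by
  have hl2 : l ^ 2 < 2 * Real.log 2 := by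
    have := Real.sq_sqrt (show 0 ≤ 2 * Real.log 2 by positivity)
    rw [← this]
    exact pow_lt_pow_left₀ hlc hl two_ne_zero
  set δ := Real.log 2 - l ^ 2 / 2 with hδ
  have hδ0 : 0 < δ := by linarith
  set C := (√(2 * Real.pi))⁻¹ * Real.exp (-(l ^ 2 / (2 * δ) + 1 / 2)) / 2 with hC
  have hC0 : 0 < C := by positivity
  have hlim : Tendsto (fun N : ℕ => Real.exp (δ / 2 * N) / (N : ℝ)) atTop atTop := by
    have h1 := (Real.tendsto_exp_div_pow_atTop 1).comp
      ((tendsto_natCast_atTop_atTop (R := ℝ)).const_mul_atTop (half_pos hδ0))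
    have h2 := h1.const_mul_atTop (half_pos hδ0)
    refine h2.congr fun N => ?_
    simp only [Function.comp, pow_one]
    field_simp
  filter_upwards [hlim.eventually_ge_atTop (2 * Real.log 2 / C), eventually_ge_atTop 1]
    with N hN hN1
  have hNpos : (0 : ℝ) < N := by exact_mod_cast hN1
  rw [div_le_div_iff₀ hC0 hNpos] at hN
  refine hN.trans ?_
  have hpow : (2 : ℝ) ^ N / 2 ≤ 2 ^ N - 1 := by
    have : (2 : ℝ) ^ 1 ≤ 2 ^ N := pow_le_pow_right₀ one_le_two hN1
    linarith
  have hs := Real.sq_sqrt hNpos.le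
  have hexp : δ / 2 * N - (l ^ 2 / (2 * δ) + 1 / 2) ≤
      N * Real.log 2 + -(l * √N + 1) ^ 2 / 2 := by
    have h1 : l * √N ≤ δ / 2 * N + l ^ 2 / (2 * δ) := by
      have h2 : 0 ≤ (δ * √N - l) ^ 2 / (2 * δ) := by positivity
      have h3 : (δ * √N - l) ^ 2 / (2 * δ) = δ / 2 * √N ^ 2 - l * √N + l ^ 2 / (2 * δ) := by
        field_simp
        ring
      rw [h3, hs] at h2
      linarith
    have h4 : -(l * √N + 1) ^ 2 / 2 = -(l ^ 2 / 2 * N) - l * √N - 1 / 2 := by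
      rw [← hs, Real.sqrt_sq (Real.sqrt_nonneg _)]
      ring
    rw [h4]
    have : δ * N = N * Real.log 2 - l ^ 2 / 2 * N := by rw [hδ]; ring
    linarith
  calc Real.exp (δ / 2 * N) * C
      = (√(2 * Real.pi))⁻¹ / 2 * Real.exp (δ / 2 * N - (l ^ 2 / (2 * δ) + 1 / 2)) := by
        rw [hC, sub_eq_add_neg, Real.exp_add]
        ring
    _ ≤ (√(2 * Real.pi))⁻¹ / 2 * Real.exp (N * Real.log 2 + -(l * √N + 1) ^ 2 / 2) := by gcongr
    _ = 2 ^ N / 2 * ((√(2 * Real.pi))⁻¹ * Real.exp (-(l * √N + 1) ^ 2 / 2)) := by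
        rw [Real.exp_add, Real.exp_nat_mul, Real.exp_log two_pos]
        ring
    _ ≤ (2 ^ N - 1) * Φ (-(l * √N)) := by
        have := le_cdf_gaussian (mul_nonneg hl (Real.sqrt_nonneg N))
        have : (0 : ℝ) ≤ 2 ^ N - 1 := le_trans (by positivity) hpow
        gcongr

/-- Almost surely, eventually at least two energies lie below `-l N`, for `0 ≤ l < β_c`. -/
theorem ae_eventually_second_lowest_le {H : (N : ℕ) → Ω → Config N → ℝ} (hH : IsREM P H)
    {l : ℝ} (hl : 0 ≤ l) (hlc : l < betaC) :
    ∀ᵐ ω ∂P, ∀ᶠ N : ℕ in atTop, ∀ hN : 1 ≤ N, H N ω (secondConfig hN (H N ω)) ≤ -l * N := by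
  obtain ⟨N₀, hN₀⟩ := eventually_atTop.1 (eventually_le_expected_number hl hlc)
  let s (N : ℕ) : Set Ω :=
    {ω | ∃ hN : 1 ≤ N, N₀ ≤ N ∧ -l * N < H N ω (secondConfig hN (H N ω))}
  have hs (N : ℕ) : P (s N) ≤ ENNReal.ofReal ((1 / 2) ^ N) := by
    by_cases hN : 1 ≤ N ∧ N₀ ≤ N
    · refine (measure_mono ?_).trans
        ((measure_second_lowest_gt_le hN.1 (hH.law N hN.1) (hH.indep N hN.1) l).trans
        (ENNReal.ofReal_le_ofReal ?_))
      · rintro ω ⟨_, _, h⟩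
        exact h
      · calc _ ≤ 2 ^ N * Real.exp (-(2 * Real.log 2 * N)) := by
              refine mul_le_mul_of_nonneg_left ?_ (by positivity)
              exact Real.exp_le_exp.2 (neg_le_neg (hN₀ N hN.2))
          _ = (1 / 2) ^ N := by
              have : -(2 * Real.log 2 * N) = N * -(Real.log 2 + Real.log 2) := by ring
              rw [this, Real.exp_nat_mul, Real.exp_neg, Real.exp_add, Real.exp_log two_pos,
                ← mul_pow]
              norm_num
    · have : s N = ∅ := by
        ext ω
        simp only [s, Set.mem_ofPred_eq, Set.mem_empty_iff_false, iff_false]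
        rintro ⟨h1, h2, _⟩
        exact hN ⟨h1, h2⟩
      simp [this]
  have hsum : ∑' N, P (s N) ≠ ∞ := by
    refine ne_top_of_le_ne_top ?_ (ENNReal.tsum_le_tsum hs)
    exact summable_geometric_two.tsum_ofReal_ne_top
  filter_upwards [ae_eventually_notMem hsum] with ω hω
  filter_upwards [hω, eventually_ge_atTop N₀] with N h1 h2 hN
  by_contra! h3
  exact h1 ⟨hN, h2, h3⟩

theorem ae_eventually_lowerBound_sub_le_dTV {H : (N : ℕ) → Ω → Config N → ℝ} (hH : IsREM P H)
    {β : ℝ} (hβ : 0 < β) :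
    ∀ᵐ ω ∂P, ∀ ε > 0, ∀ᶠ N : ℕ in atTop,
      lowerBound β (spacing (H N ω) 1) (spacing (H N ω) 2) - ε ≤
        dTV (gibbs β (H N ω)) (PMF.pure (minConfig (H N ω))) := by
  have hc := betaC_pos
  have h (k : ℕ) := ae_eventually_second_lowest_le hH (l := betaC / (1 + 1 / ((k : ℝ) + 1)))
    (by positivity) (div_lt_self hc (by simp; positivity))
  filter_upwards [ae_all_iff.2 h] with ω hω ε hε
  obtain ⟨k, hk⟩ := exists_nat_one_div_lt hε
  filter_upwards [hω k, eventually_ge_atTop 1] with N hN1 hN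
  have := lowerBound_sub_le_dTV hN hβ (H N ω) (t := 1 + 1 / ((k : ℝ) + 1))
    (by simp; positivity) (hN1 hN)
  linarith

theorem le_liminf_of_forall_pos_sub_le {u : ℕ → ℝ} {a M : ℝ} (hM : ∀ N, u N ≤ M)
    (h : ∀ ε > 0, ∀ᶠ N in atTop, a - ε ≤ u N) : a ≤ liminf u atTop := by
  refine le_of_forall_pos_le_add fun ε hε => ?_
  have : a - ε ≤ liminf u atTop := le_liminf_of_le
    (isBoundedUnder_of ⟨M, hM⟩).isCoboundedUnder_ge (h ε hε)
  linarith

theorem map_prod_eq_compProd {A B U : Type*} [MeasurableSpace A] [MeasurableSpace B]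
    [MeasurableSpace U] {ν : Measure A} [SFinite ν] {ρ : Measure U} [SFinite ρ]
    {κ : Kernel A B} [IsSFiniteKernel κ] {f : A → U → B} (hf : Measurable (Function.uncurry f))
    (hκ : ∀ a, ρ.map (f a) = κ a) :
    (ν.prod ρ).map (fun p => (p.1, f p.1 p.2)) = ν ⊗ₘ κ := by
  have hm : Measurable fun p : A × U => (p.1, f p.1 p.2) := measurable_fst.prodMk hf
  ext s hs
  rw [Measure.map_apply hm hs, Measure.prod_apply (hm hs), Measure.compProd_apply hs]
  refine lintegral_congr fun a => ?_
  have hfa : Measurable (f a) := hf.comp measurable_prodMk_left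
  rw [← hκ a, Measure.map_apply hfa (measurable_prodMk_left hs)]
  rfl

/-- A random variable can be resampled, with an independent uniform variable, from the value of
one of its measurable functions. -/
theorem exists_measurable_map_prod_eq {A B : Type*} [MeasurableSpace A] [MeasurableSpace B]
    [StandardBorelSpace B] [Nonempty B] {μ : Measure B} [IsProbabilityMeasure μ] {S : B → A}
    (hS : Measurable S) :
    ∃ f : A → unitInterval → B, Measurable (Function.uncurry f) ∧
      ((μ.map S).prod volume).map (fun p => (p.1, f p.1 p.2)) = μ.map fun x => (S x, x) := by
  obtain ⟨f, hf, hκ⟩ := (condDistrib id S μ).exists_measurable_map_eq_unitInterval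
  have := Measure.isProbabilityMeasure_map (μ := μ) hS.aemeasurable
  exact ⟨f, hf, (map_prod_eq_compProd hf hκ).trans (compProd_map_condDistrib aemeasurable_id)⟩

/-- The law of the energies of a volume. -/
noncomputable def energyLaw (N : ℕ) : Measure (Config N → ℝ) :=
  Measure.pi fun _ => gaussianReal 0 (N : ℝ≥0)

instance (N : ℕ) : IsProbabilityMeasure (energyLaw N) := by
  unfold energyLaw
  infer_instance

theorem map_spacings_energyLaw {N : ℕ} (hN : 1 ≤ N) :
    (energyLaw N).map spacings = Measure.pi fun _ : Fin (2 ^ N) => expMeasure 1 :=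
  (hasLaw_spacings (P := energyLaw N) (X := id) hN
    (fun σ => (measurePreserving_eval (fun _ => gaussianReal 0 (N : ℝ≥0)) σ).hasLaw)
    (iIndepFun_pi (X := fun _ x => x) fun _ => aemeasurable_id)).map_eq

theorem exists_isREM_representedBy :
    ∃ (Ω : Type) (_ : MeasurableSpace Ω) (P : Measure Ω) (_ : IsProbabilityMeasure P)
      (H : (N : ℕ) → Ω → Config N → ℝ) (W : ℕ → Ω → ℝ), IsREM P H ∧ RepresentedBy P H W := by
  choose f hf hmap using fun N =>
    exists_measurable_map_prod_eq (μ := energyLaw N) (measurable_spacings N)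
  let ν : Measure (ℕ → ℝ) := Measure.infinitePi fun _ => expMeasure 1
  let w (N : ℕ) (x : ℕ → ℝ) (i : Fin (2 ^ N)) : ℝ := x (i + 1)
  have hwm (N) : Measurable (w N) := measurable_pi_lambda _ fun i => measurable_pi_apply _
  have hw (N) : ν.map (w N) = Measure.pi fun _ : Fin (2 ^ N) => expMeasure 1 := by
    refine (iIndepFun.hasLaw_pi (X := fun (i : Fin (2 ^ N)) (x : ℕ → ℝ) => x (i + 1))
      (fun i => ?_) ?_).map_eq
    · exact (measurePreserving_eval_infinitePi (fun _ : ℕ => expMeasure 1) _).hasLaw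
    · refine (iIndepFun_infinitePi (P := fun _ : ℕ => expMeasure 1) (X := fun _ x => x)
        fun _ => measurable_id).precomp (g := fun i : Fin (2 ^ N) => (i : ℕ) + 1) fun i j hij => ?_
      exact Fin.ext (Nat.succ_injective hij)
  let P : Measure ((ℕ → ℝ) × unitInterval) := ν.prod volume
  let H (N : ℕ) (ω : (ℕ → ℝ) × unitInterval) : Config N → ℝ := f N (w N ω.1) ω.2
  have hHm (N) : Measurable (H N) :=
    (hf N).comp (((hwm N).comp measurable_fst).prodMk measurable_snd)
  have hwH (N) : Measurable fun ω : (ℕ → ℝ) × unitInterval => (w N ω.1, H N ω) :=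
    ((hwm N).comp measurable_fst).prodMk (hHm N)
  have hSx (N) : Measurable fun x : Config N → ℝ => (spacings x, x) :=
    (measurable_spacings N).prodMk measurable_id
  have hjoint (N) (hN : 1 ≤ N) :
      P.map (fun ω => (w N ω.1, H N ω)) = (energyLaw N).map fun x => (spacings x, x) := by
    have h1 : P.map (fun ω => (w N ω.1, ω.2)) = ((energyLaw N).map spacings).prod volume := by
      rw [map_spacings_energyLaw hN, ← hw N]
      exact (((hwm N).measurePreserving ν).prod (MeasurePreserving.id volume)).map_eq
    rw [← hmap N, ← h1]
    exact (Measure.map_map (measurable_fst.prodMk (hf N))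
      (((hwm N).comp measurable_fst).prodMk measurable_snd)).symm
  have hHlaw (N) (hN : 1 ≤ N) : P.map (H N) = energyLaw N := by
    have h := congrArg (Measure.map Prod.snd) (hjoint N hN)
    rw [Measure.map_map measurable_snd (hwH N), Measure.map_map measurable_snd (hSx N)] at h
    exact h.trans Measure.map_id
  have hlaw (N) (hN : 1 ≤ N) (σ : Config N) :
      HasLaw (fun ω => H N ω σ) (gaussianReal 0 (N : ℝ≥0)) P :=
    (measurePreserving_eval (fun _ => gaussianReal 0 (N : ℝ≥0)) σ).hasLaw.comp
      ⟨(hHm N).aemeasurable, hHlaw N hN⟩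
  refine ⟨_, inferInstance, P, inferInstance, H, fun i ω => ω.1 i, ⟨hlaw, fun N hN => ?_⟩, ?_⟩
  · exact (iIndepFun_iff_hasLaw_pi_pi (hlaw N hN)).2 ⟨(hHm N).aemeasurable, hHlaw N hN⟩
  · intro N hN i h1 h2
    obtain ⟨k, rfl⟩ := Nat.exists_eq_add_of_le' h1
    have hms : MeasurableSet {p : (Fin (2 ^ N) → ℝ) × (Config N → ℝ) | spacings p.2 = p.1} :=
      measurableSet_eq_fun ((measurable_spacings N).comp measurable_snd) measurable_fst
    have hae : ∀ᵐ p ∂P.map (fun ω => (w N ω.1, H N ω)), spacings p.2 = p.1 := by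
      rw [hjoint N hN, ae_map_iff (hSx N).aemeasurable hms]
      exact ae_of_all _ fun _ => rfl
    rw [ae_map_iff (hwH N).aemeasurable hms] at hae
    filter_upwards [hae] with ω hω
    exact congrFun hω ⟨k, h2⟩

end REM

theorem mainTheorem9 (β : ℝ) (hβ : REM.betaC < β) :
    -- in finite volume the Gibbs measure is not the point mass at the minimum
    (∀ N : ℕ, 1 ≤ N → ∀ h : REM.Config N → ℝ,
      REM.gibbs β h ≠ PMF.pure (REM.minConfig h)) ∧
    (∀ (Ω : Type*) [MeasurableSpace Ω] (P : Measure Ω) [IsProbabilityMeasure P]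
      (H : (N : ℕ) → Ω → REM.Config N → ℝ), REM.IsREM P H →
      -- for each `N`, the variables `W_1^{(N)}, …, W_n^{(N)}`, `n = 2^N`, are i.i.d. exponential
      (∀ N, 1 ≤ N →
        (∀ i, 1 ≤ i → i ≤ 2 ^ N →
          HasLaw (fun ω => REM.spacing (H N ω) i) (expMeasure 1) P) ∧
        iIndepFun (fun (i : Fin (2 ^ N)) ω => REM.spacing (H N ω) (i + 1)) P) ∧
      -- the lower bound, whatever the joint law of the different volumes
      (∀ᵐ ω ∂P, 0 ≤ liminf (fun N : ℕ =>
        REM.dTV (REM.gibbs β (H N ω)) (PMF.pure (REM.minConfig (H N ω)))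
          - REM.lowerBound β (REM.spacing (H N ω) 1) (REM.spacing (H N ω) 2)) atTop) ∧
      -- the strictly positive liminf, when one sequence `W` represents all volumes
      (∀ W : ℕ → Ω → ℝ, REM.RepresentedBy P H W →
        (∀ i, 1 ≤ i → HasLaw (W i) (expMeasure 1) P) ∧
        iIndepFun (fun i : ℕ => W (i + 1)) P ∧
        ∀ᵐ ω ∂P,
          REM.lowerBound β (W 1 ω) (W 2 ω) ≤ liminf (fun N : ℕ =>
            REM.dTV (REM.gibbs β (H N ω)) (PMF.pure (REM.minConfig (H N ω)))) atTop ∧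
          0 < REM.lowerBound β (W 1 ω) (W 2 ω))) ∧
    -- such a representation exists
    (∃ (Ω : Type) (_ : MeasurableSpace Ω) (P : Measure Ω) (_ : IsProbabilityMeasure P)
      (H : (N : ℕ) → Ω → REM.Config N → ℝ) (W : ℕ → Ω → ℝ),
      REM.IsREM P H ∧ REM.RepresentedBy P H W) := by
  have hβ0 : 0 < β := REM.betaC_pos.trans hβ
  refine ⟨fun N hN h => REM.gibbs_ne_pure hN β h, fun Ω _ P _ H hH => ⟨fun N hN =>
    REM.spacing_hasLaw_and_iIndepFun hH hN, ?_, fun W hW => ?_⟩, REM.exists_isREM_representedBy⟩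
  · filter_upwards [REM.ae_eventually_lowerBound_sub_le_dTV hH hβ0] with ω hω
    refine REM.le_liminf_of_forall_pos_sub_le (M := 2) (fun N => ?_) fun ε hε => ?_
    · linarith [REM.dTV_le_two (REM.gibbs β (H N ω)) (PMF.pure (REM.minConfig (H N ω))),
        REM.lowerBound_pos β (REM.spacing (H N ω) 1) (REM.spacing (H N ω) 2)]
    · filter_upwards [hω ε hε] with N hN
      linarith
  · obtain ⟨h1, h2⟩ := hW.hasLaw_and_iIndepFun hH
    refine ⟨h1, h2, ?_⟩
    have hrep (i : ℕ) (hi : 1 ≤ i) (hi2 : i ≤ 2) :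
        ∀ᵐ ω ∂P, ∀ N : ℕ, 1 ≤ N → REM.spacing (H N ω) i = W i ω := by
      refine ae_all_iff.2 fun N => ?_
      by_cases hN : 1 ≤ N
      · have : 2 ≤ 2 ^ N := Nat.le_self_pow (by omega) 2
        filter_upwards [hW N hN i hi (hi2.trans this)] with ω hω _ using hω
      · exact ae_of_all _ fun _ h => absurd h hN
    filter_upwards [REM.ae_eventually_lowerBound_sub_le_dTV hH hβ0, hrep 1 le_rfl one_le_two,
      hrep 2 one_le_two le_rfl] with ω hω hW1 hW2
    refine ⟨REM.le_liminf_of_forall_pos_sub_le (fun N => REM.dTV_le_two _ _) fun ε hε => ?_,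
      REM.lowerBound_pos _ _ _⟩
    filter_upwards [hω ε hε, eventually_ge_atTop 1] with N hN hN1
    rwa [hW1 N hN1, hW2 N hN1] at hN
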